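/- Let $d\ge 1$, $\gamma,c_1,C_1,T>0$. Let $p_0$ be a probability density on $\mathbb R^d$ with $p_0(x)\le C_1\exp(-c_1\|x\|^\gamma)$ for all $x$, and let $X^{(1)},\dots,X^{(n)}$ be i.i.d. with density $p_0$, $n\ge 2$. For $t>0$ put $\varphi_t(x)=(2\pi t)^{-d/2}\exp(-\|x\|^2/(2t))$, $p_t=\varphi_t*p_0$, $s_t=\nabla\log p_t$, and $$\hat p_t(x)=\frac1n\sum_{i=1}^n\varphi_t(x-X^{(i)}),\quad \nabla\hat p_t(x)=\frac1{nt}\sum_{i=1}^n (X^{(i)}-x)\varphi_t(x-X^{(i)}),\quad \rho_n=\frac{\log n}{n(2\pi t)^{d/2}},$$ $$\hat s_t(x)=\frac{\nabla\hat p_t(x)}{\hat p_t(x)}\,\mathbf 1_{\{\hat p_t(x)\ge\rho_n\}}.$$ Then there are constants $C,K>0$, depending only on $d,\gamma,c_1,C_1,T$, such that for every such $p_0$, every $n\ge2$ and every $t\in(0,T]$, $$\mathbb E\left[\int_{\mathbb R^d}\|\hat s_t(x)-s_t(x)\|^2\,p_t(x)\,dx\right]\le C(\log n)^{K}\,n^{-1}\,t^{-1-d/2}.$$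 In particular, the tail index $\gamma$ does not affect the powers of $n$ and $t$, only the polylogarithmic factor $C(\log n)^K$ (for $n\ge 3$ the constant $C$ can be absorbed by enlarging $K$). -/

import Mathlib

open MeasureTheory ProbabilityTheory
open scoped ENNReal

namespace ScoreKDE

/-- `p` is a (Lebesgue) probability density on `ℝᵈ`. -/
structure IsDensity {d : ℕ} (p : EuclideanSpace ℝ (Fin d) → ℝ) : Prop where
  measurable : Measurable p
  nonneg : ∀ x, 0 ≤ p x
  integrable : Integrable p
  integral_eq_one : ∫ x, p x = 1

/-- Stretched-exponential tail decay: `p x ≤ C₁ exp (-c₁ ‖x‖ ^ γ)` for every `x`. -/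
def ExpTail {d : ℕ} (γ c₁ C₁ : ℝ) (p : EuclideanSpace ℝ (Fin d) → ℝ) : Prop :=
  ∀ x, p x ≤ C₁ * Real.exp (-c₁ * ‖x‖ ^ γ)

/-- The probability measure on `ℝᵈ` with Lebesgue density `p`. -/
noncomputable def densityMeasure {d : ℕ} (p : EuclideanSpace ℝ (Fin d) → ℝ) :
    Measure (EuclideanSpace ℝ (Fin d)) :=
  volume.withDensity (fun x => ENNReal.ofReal (p x))

/-- The Gaussian transition density `φ_t(x) = (2πt)^{-d/2} exp (-‖x‖² / (2t))`. -/
noncomputable def gaussKernel {d : ℕ} (t : ℝ) (x : EuclideanSpace ℝ (Fin d)) : ℝ :=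
  1 / (2 * Real.pi * t) ^ ((d : ℝ) / 2) * Real.exp (-‖x‖ ^ 2 / (2 * t))

/-- The marginal density `p_t = φ_t * p₀` of `X_t = X₀ + √t Z`. -/
noncomputable def marginal {d : ℕ} (p₀ : EuclideanSpace ℝ (Fin d) → ℝ) (t : ℝ)
    (x : EuclideanSpace ℝ (Fin d)) : ℝ :=
  ∫ y, gaussKernel t (x - y) * p₀ y

/-- The true score `s_t = ∇ log p_t`. -/
noncomputable def score {d : ℕ} (p₀ : EuclideanSpace ℝ (Fin d) → ℝ) (t : ℝ)
    (x : EuclideanSpace ℝ (Fin d)) : EuclideanSpace ℝ (Fin d) :=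
  gradient (fun y => Real.log (marginal p₀ t y)) x

/-- The Gaussian kernel density estimator of `p_t` built from the sample `X 0, …, X (n-1)`. -/
noncomputable def kde {d n : ℕ} (X : Fin n → EuclideanSpace ℝ (Fin d)) (t : ℝ)
    (x : EuclideanSpace ℝ (Fin d)) : ℝ :=
  1 / (n : ℝ) * ∑ i, gaussKernel t (x - X i)

/-- The gradient of the kernel density estimator,
`(1 / (n t)) ∑ᵢ φ_t(x - Xᵢ) (Xᵢ - x)`. -/
noncomputable def kdeGrad {d n : ℕ} (X : Fin n → EuclideanSpace ℝ (Fin d)) (t : ℝ)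
    (x : EuclideanSpace ℝ (Fin d)) : EuclideanSpace ℝ (Fin d) :=
  (1 / ((n : ℝ) * t)) • ∑ i, gaussKernel t (x - X i) • (X i - x)

/-- The threshold `ρ_n = log n / (n (2πt)^{d/2})`. -/
noncomputable def threshold (d n : ℕ) (t : ℝ) : ℝ :=
  Real.log n / ((n : ℝ) * (2 * Real.pi * t) ^ ((d : ℝ) / 2))

open Classical in
/-- The thresholded score estimator: `∇p̂_t / p̂_t` where `p̂_t ≥ ρ_n`, and `0` elsewhere. -/
noncomputable def scoreEst {d n : ℕ} (X : Fin n → EuclideanSpace ℝ (Fin d)) (t : ℝ)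
    (x : EuclideanSpace ℝ (Fin d)) : EuclideanSpace ℝ (Fin d) :=
  if threshold d n t ≤ kde X t x then (kde X t x)⁻¹ • kdeGrad X t x else 0

/-- The weighted loss `∫ ‖ŝ_t(x) - s_t(x)‖² p_t(x) dx` for one sample, with values in `[0, ∞]`
(so that a finite bound on it includes integrability). -/
noncomputable def weightedLoss {d n : ℕ} (p₀ : EuclideanSpace ℝ (Fin d) → ℝ)
    (X : Fin n → EuclideanSpace ℝ (Fin d)) (t : ℝ) : ℝ≥0∞ :=
  ∫⁻ x, ENNReal.ofReal (‖scoreEst X t x - score p₀ t x‖ ^ 2 * marginal p₀ t x)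

end ScoreKDE

namespace ScoreKDE

/-! Write `p` for the smoothed density, `s` for its score, `M = (2πt)^{-d/2}`, and `q` for the
integral of `‖y - x‖²/t²` against the posterior weight `φ_t(x - y) dμ(y)`. The core is a risk bound,
uniform in `x`: `E ‖ŝ - s‖² p` is at most polylog(n) times `M/(nt)`.

A Fenchel inequality for the kernel (`gaussKernel_mul_sq_le`) gives `q ≤ (4/t)(p log n + M/n)`. It
bounds the true score and, applied to the sample, the thresholded estimator: both squared scores,
the true one weighted by `p`, cost only a logarithm over `t`.

Where `p ≥ 10 ρ_n`, a Chernoff bound gives `p̂ ≥ p/2` except with probability `1/n`. On that event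
`ŝ - s = (∇p̂ - p̂ s)/p̂`, whose numerator is an average of i.i.d. centred vectors with second
moment at most `M q / n`; the factor `4/p` is cancelled by `q ≲ p log n / t`. Where `p < 10 ρ_n`,
the deterministic bound on the loss is already of the right order (`lintegral_loss_le`).

Integrating over a ball of radius a power of `log n` costs only logarithms. Outside it, an
exponential Markov inequality (`lintegral_compl_ball_le`) gains a factor `1/n`. The tail index
enters only through the radius and the constants. -/

/-- The maximal value `(2πt)^{-d/2}` of the Gaussian kernel. -/
noncomputable def gaussPeak (d : ℕ) (t : ℝ) : ℝ := 1 / (2 * Real.pi * t) ^ ((d : ℝ) / 2)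

/-! ### Pointwise bounds for the Gaussian kernel -/

section Kernel

variable {d : ℕ} {t : ℝ}

theorem gaussPeak_pos (ht : 0 < t) : 0 < gaussPeak d t := by
  unfold gaussPeak; positivity

theorem gaussKernel_eq (z : EuclideanSpace ℝ (Fin d)) :
    gaussKernel t z = gaussPeak d t * Real.exp (-‖z‖ ^ 2 / (2 * t)) := rfl

theorem gaussKernel_pos (ht : 0 < t) (z : EuclideanSpace ℝ (Fin d)) : 0 < gaussKernel t z :=
  mul_pos (gaussPeak_pos ht) (Real.exp_pos _)

theorem gaussKernel_le (ht : 0 < t) (z : EuclideanSpace ℝ (Fin d)) :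
    gaussKernel t z ≤ gaussPeak d t := by
  rw [gaussKernel_eq]
  refine mul_le_of_le_one_right (gaussPeak_pos ht).le (Real.exp_le_one_iff.2 ?_)
  rw [neg_div]
  exact neg_nonpos.2 (by positivity)

@[fun_prop]
theorem continuous_gaussKernel :
    Continuous (gaussKernel t : EuclideanSpace ℝ (Fin d) → ℝ) := by
  unfold gaussKernel; fun_prop

@[fun_prop]
theorem measurable_gaussKernel :
    Measurable (gaussKernel t : EuclideanSpace ℝ (Fin d) → ℝ) :=
  continuous_gaussKernel.measurable

/-- The Fenchel-type inequality that replaces Jensen's inequality for the posterior. -/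
theorem gaussKernel_mul_sq_le (ht : 0 < t) {N : ℝ} (hN : 0 < N) (z : EuclideanSpace ℝ (Fin d)) :
    gaussKernel t z * (‖z‖ ^ 2 / t ^ 2) ≤
      4 / t * (Real.log N * gaussKernel t z + gaussPeak d t / N) := by
  set a := ‖z‖ ^ 2 / (4 * t) with ha
  have ha0 : 0 ≤ a := by positivity
  have h1 : ‖z‖ ^ 2 / t ^ 2 = 4 / t * a := by rw [ha]; field_simp
  have h2 : -‖z‖ ^ 2 / (2 * t) = -a + -a := by rw [ha]; field_simp; ring
  have hM := gaussPeak_pos (d := d) ht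
  rw [h1, gaussKernel_eq, h2, Real.exp_add]
  -- The kernel is `M e^{-2a}`. In `a ≤ log N + e^a / N`, one factor `e^{-a}` cancels `e^a` and the
  -- other is at most 1.
  have h3 := Real.add_one_le_exp (a - Real.log N)
  rw [Real.exp_sub, Real.exp_log hN] at h3
  have he : Real.exp (-a) ≤ 1 := Real.exp_le_one_iff.2 (by linarith)
  have he0 := Real.exp_pos (-a)
  have hee : Real.exp a * Real.exp (-a) = 1 := by rw [← Real.exp_add]; simp
  have key : a * (Real.exp (-a) * Real.exp (-a)) ≤
      Real.log N * (Real.exp (-a) * Real.exp (-a)) + 1 / N := by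
    have h4 : (a - Real.log N + 1) * (Real.exp (-a) * Real.exp (-a)) ≤
        Real.exp a / N * (Real.exp (-a) * Real.exp (-a)) := by gcongr
    have h5 : Real.exp a / N * (Real.exp (-a) * Real.exp (-a)) = Real.exp (-a) / N := by
      calc _ = (Real.exp a * Real.exp (-a)) * Real.exp (-a) / N := by ring
        _ = _ := by rw [hee, one_mul]
    have h6 : Real.exp (-a) / N ≤ 1 / N := by gcongr
    have h7 : 0 < Real.exp (-a) * Real.exp (-a) := by positivity
    linarith
  calc gaussPeak d t * (Real.exp (-a) * Real.exp (-a)) * (4 / t * a)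
      = gaussPeak d t * (4 / t) * (a * (Real.exp (-a) * Real.exp (-a))) := by ring
    _ ≤ gaussPeak d t * (4 / t) *
        (Real.log N * (Real.exp (-a) * Real.exp (-a)) + 1 / N) := by gcongr
    _ = _ := by ring

theorem gaussKernel_mul_sq_le_const (ht : 0 < t) (z : EuclideanSpace ℝ (Fin d)) :
    gaussKernel t z * (‖z‖ ^ 2 / t ^ 2) ≤ 4 / t * gaussPeak d t := by
  simpa using gaussKernel_mul_sq_le ht one_pos z

theorem gaussKernel_mul_norm_le (ht : 0 < t) (z : EuclideanSpace ℝ (Fin d)) :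
    gaussKernel t z * (‖z‖ / t) ≤ gaussPeak d t + 4 / t * gaussPeak d t := by
  have h1 := gaussKernel_mul_sq_le_const ht z
  have h2 := gaussKernel_le ht z
  have h3 : ‖z‖ / t ≤ 1 + ‖z‖ ^ 2 / t ^ 2 := by
    rw [← div_pow]; nlinarith [sq_nonneg (‖z‖ / t - 1), sq_nonneg (‖z‖ / t)]
  have h4 := mul_le_mul_of_nonneg_left h3 (gaussKernel_pos ht z).le
  linarith

theorem hasFDerivAt_gaussKernel (ht : 0 < t) (z : EuclideanSpace ℝ (Fin d)) :
    HasFDerivAt (gaussKernel t) (gaussKernel t z • innerSL ℝ (-(t⁻¹ • z))) z := by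
  have h1 : HasFDerivAt (fun z : EuclideanSpace ℝ (Fin d) => ‖z‖ ^ 2) (2 • innerSL ℝ z) z :=
    (hasStrictFDerivAt_norm_sq z).hasFDerivAt
  have h2 := ((h1.const_mul (-(1 / (2 * t)))).exp).const_mul (gaussPeak d t)
  have e : (gaussKernel t : EuclideanSpace ℝ (Fin d) → ℝ) = fun z =>
      gaussPeak d t * Real.exp (-(1 / (2 * t)) * ‖z‖ ^ 2) := by
    ext z; rw [gaussKernel_eq]; congr 2; ring
  have e' := congrFun e z
  rw [e'] 
  rw [e]
  refine h2.congr_fderiv ?_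
  ext v
  simp
  field_simp

end Kernel

/-! ### Gaussian smoothing of a probability measure and its score -/

/-- The density `φ_t * μ` of the Gaussian smoothing of a measure. -/
noncomputable def smooth {d : ℕ} (μ : Measure (EuclideanSpace ℝ (Fin d))) (t : ℝ)
    (x : EuclideanSpace ℝ (Fin d)) : ℝ :=
  ∫ y, gaussKernel t (x - y) ∂μ

/-- The gradient of `smooth μ t`. -/
noncomputable def smoothGrad {d : ℕ} (μ : Measure (EuclideanSpace ℝ (Fin d))) (t : ℝ)
    (x : EuclideanSpace ℝ (Fin d)) : EuclideanSpace ℝ (Fin d) :=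
  ∫ y, gaussKernel t (x - y) • t⁻¹ • (y - x) ∂μ

/-- The second moment of `(y - x) / t` under the weight `φ_t(x - y) dμ(y)`. -/
noncomputable def smoothSq {d : ℕ} (μ : Measure (EuclideanSpace ℝ (Fin d))) (t : ℝ)
    (x : EuclideanSpace ℝ (Fin d)) : ℝ :=
  ∫ y, gaussKernel t (x - y) * (‖x - y‖ ^ 2 / t ^ 2) ∂μ

theorem smoothSq_nonneg {d : ℕ} {t : ℝ} (μ : Measure (EuclideanSpace ℝ (Fin d))) (ht : 0 < t)
    (x : EuclideanSpace ℝ (Fin d)) : 0 ≤ smoothSq μ t x :=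
  integral_nonneg fun y => mul_nonneg (gaussKernel_pos ht _).le (by positivity)

section Smooth

variable {d : ℕ} {t : ℝ} (μ : Measure (EuclideanSpace ℝ (Fin d))) [IsProbabilityMeasure μ]

theorem integrable_gaussKernel_sub (ht : 0 < t) (x : EuclideanSpace ℝ (Fin d)) :
    Integrable (fun y => gaussKernel t (x - y)) μ := by
  refine Integrable.of_bound (C := gaussPeak d t) (by fun_prop) (ae_of_all _ fun y => ?_)
  rw [Real.norm_of_nonneg (gaussKernel_pos ht _).le]
  exact gaussKernel_le ht _

theorem integrable_gaussKernel_sub_mul_sq (ht : 0 < t) (x : EuclideanSpace ℝ (Fin d)) :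
    Integrable (fun y => gaussKernel t (x - y) * (‖x - y‖ ^ 2 / t ^ 2)) μ := by
  refine Integrable.of_bound (C := 4 / t * gaussPeak d t)
    (Continuous.aestronglyMeasurable (by fun_prop)) (ae_of_all _ fun y => ?_)
  have := gaussKernel_pos ht (x - y)
  rw [Real.norm_of_nonneg (by positivity)]
  exact gaussKernel_mul_sq_le_const ht _

theorem norm_gaussKernel_sub_smul_le (ht : 0 < t) (x y : EuclideanSpace ℝ (Fin d)) :
    ‖gaussKernel t (x - y) • t⁻¹ • (y - x)‖ ≤ gaussPeak d t + 4 / t * gaussPeak d t := by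
  have h := gaussKernel_mul_norm_le ht (x - y)
  rwa [norm_smul, norm_smul, Real.norm_of_nonneg (gaussKernel_pos ht _).le,
    Real.norm_of_nonneg (inv_nonneg.2 ht.le), norm_sub_rev, mul_comm t⁻¹, ← div_eq_mul_inv]

theorem integrable_gaussKernel_sub_smul (ht : 0 < t) (x : EuclideanSpace ℝ (Fin d)) :
    Integrable (fun y => gaussKernel t (x - y) • t⁻¹ • (y - x)) μ :=
  Integrable.of_bound (C := gaussPeak d t + 4 / t * gaussPeak d t)
    (Continuous.aestronglyMeasurable (by fun_prop))
    (ae_of_all _ fun y => norm_gaussKernel_sub_smul_le ht x y)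

theorem smooth_pos (ht : 0 < t) (x : EuclideanSpace ℝ (Fin d)) : 0 < smooth μ t x := by
  unfold smooth
  rw [integral_pos_iff_support_of_nonneg (fun y => (gaussKernel_pos ht _).le)
    (integrable_gaussKernel_sub μ ht x)]
  have : (Function.support fun y => gaussKernel t (x - y)) = Set.univ := by
    ext y; simpa using (gaussKernel_pos ht (x - y)).ne'
  simp [this]

theorem smooth_le (ht : 0 < t) (x : EuclideanSpace ℝ (Fin d)) :
    smooth μ t x ≤ gaussPeak d t := by
  have := integral_mono (integrable_gaussKernel_sub μ ht x) (integrable_const (gaussPeak d t))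
    (fun y => gaussKernel_le ht (x - y))
  simpa [smooth] using this

/-- The integrated Fenchel inequality. With `N = n` the additive error `M/n` is the threshold `ρ_n`
divided by `log n`. -/
theorem smoothSq_le (ht : 0 < t) {N : ℝ} (hN : 0 < N) (x : EuclideanSpace ℝ (Fin d)) :
    smoothSq μ t x ≤ 4 / t * (Real.log N * smooth μ t x + gaussPeak d t / N) := by
  have hi := integrable_gaussKernel_sub μ ht x
  have := integral_mono (integrable_gaussKernel_sub_mul_sq μ ht x)
    (((hi.const_mul (Real.log N)).add (integrable_const (gaussPeak d t / N))).const_mul (4 / t))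
    (fun y => gaussKernel_mul_sq_le ht hN (x - y))
  refine this.trans (le_of_eq ?_)
  rw [integral_const_mul]
  congr 1
  simp only [Pi.add_apply]
  rw [integral_add (hi.const_mul _) (integrable_const _), integral_const_mul]
  simp [smooth]

/-- Since `φ_t(z) ‖z‖ / t` is bounded in `z`, a constant dominates the derivative, so no moment of
`μ` is needed to differentiate under the integral. -/
theorem hasGradientAt_smooth (ht : 0 < t) (x : EuclideanSpace ℝ (Fin d)) :
    HasGradientAt (smooth μ t) (smoothGrad μ t x) x := by
  rw [hasGradientAt_iff_hasFDerivAt]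
  have key := hasFDerivAt_integral_of_dominated_of_fderiv_le (𝕜 := ℝ) (μ := μ)
    (F := fun x y => gaussKernel t (x - y))
    (F' := fun x y => innerSL ℝ (gaussKernel t (x - y) • t⁻¹ • (y - x)))
    (bound := fun _ => gaussPeak d t + 4 / t * gaussPeak d t) (x₀ := x) (s := Set.univ)
    Filter.univ_mem
    (Filter.Eventually.of_forall fun z => (integrable_gaussKernel_sub μ ht z).aestronglyMeasurable)
    (integrable_gaussKernel_sub μ ht x)
    (Continuous.aestronglyMeasurable (by fun_prop))
    (ae_of_all _ fun y z _ => by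
      rw [innerSL_apply_norm]; exact norm_gaussKernel_sub_smul_le ht z y)
    (integrable_const _)
    (ae_of_all _ fun y z _ => by
      have h := (hasFDerivAt_gaussKernel ht (z - y)).comp z ((hasFDerivAt_id z).sub_const y)
      refine h.congr_fderiv ?_
      ext v
      simp only [← smul_neg, neg_sub]
      simp)
  have e : ∫ y, innerSL ℝ (gaussKernel t (x - y) • t⁻¹ • (y - x)) ∂μ
      = innerSL ℝ (smoothGrad μ t x) :=
    (innerSL ℝ).integral_comp_comm (integrable_gaussKernel_sub_smul μ ht x)
  rw [e] at key
  refine key.congr_fderiv ?_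
  ext v
  simp [InnerProductSpace.toDual_apply_apply]

theorem gradient_log_smooth (ht : 0 < t) (x : EuclideanSpace ℝ (Fin d)) :
    gradient (fun y => Real.log (smooth μ t y)) x = (smooth μ t x)⁻¹ • smoothGrad μ t x := by
  apply HasGradientAt.gradient
  have h := hasGradientAt_smooth μ ht x
  rw [hasGradientAt_iff_hasFDerivAt] at h ⊢
  refine (h.log (smooth_pos μ ht x).ne').congr_fderiv ?_
  ext v
  simp [InnerProductSpace.toDual_apply_apply]

theorem measurable_smooth (ht : 0 < t) : Measurable (smooth μ t) :=
  (continuous_iff_continuousAt.2 fun x =>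
    (hasGradientAt_smooth μ ht x).differentiableAt.continuousAt).measurable

variable {μ} in
theorem smoothGrad_eq {s : EuclideanSpace ℝ (Fin d)} (ht : 0 < t) {x : EuclideanSpace ℝ (Fin d)}
    (hs : s = (smooth μ t x)⁻¹ • smoothGrad μ t x) : smoothGrad μ t x = smooth μ t x • s := by
  rw [hs, smul_inv_smul₀ (smooth_pos μ ht x).ne']

/-- Bias-variance identity for the posterior weight `φ_t(x - y) dμ(y)`. -/
theorem integral_gaussKernel_mul_norm_sub_sq (ht : 0 < t) {x s : EuclideanSpace ℝ (Fin d)}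
    (hs : smoothGrad μ t x = smooth μ t x • s) :
    Integrable (fun y => gaussKernel t (x - y) * ‖t⁻¹ • (y - x) - s‖ ^ 2) μ ∧
    ∫ y, gaussKernel t (x - y) * ‖t⁻¹ • (y - x) - s‖ ^ 2 ∂μ =
      smoothSq μ t x - ‖s‖ ^ 2 * smooth μ t x := by
  have h1 := integrable_gaussKernel_sub_mul_sq μ ht x
  have h2 := integrable_gaussKernel_sub_smul μ ht x
  have h2' : Integrable (fun y => inner ℝ s (gaussKernel t (x - y) • t⁻¹ • (y - x))) μ :=
    h2.const_inner s
  have h3 := integrable_gaussKernel_sub μ ht x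
  have e : (fun y => gaussKernel t (x - y) * ‖t⁻¹ • (y - x) - s‖ ^ 2) =
      fun y => gaussKernel t (x - y) * (‖x - y‖ ^ 2 / t ^ 2) -
        2 * inner ℝ s (gaussKernel t (x - y) • t⁻¹ • (y - x)) +
        ‖s‖ ^ 2 * gaussKernel t (x - y) := by
    ext y
    rw [norm_sub_sq_real, inner_smul_right, real_inner_comm s, norm_smul, norm_sub_rev x y,
      Real.norm_of_nonneg (inv_nonneg.2 ht.le)]
    field_simp
  rw [e]
  have h4 : Integrable (fun y => gaussKernel t (x - y) * (‖x - y‖ ^ 2 / t ^ 2) -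
      2 * inner ℝ s (gaussKernel t (x - y) • t⁻¹ • (y - x))) μ := h1.sub (h2'.const_mul 2)
  refine ⟨h4.add (h3.const_mul _), ?_⟩
  rw [integral_add h4 (h3.const_mul _),
    integral_sub h1 (h2'.const_mul 2), integral_const_mul, integral_const_mul,
    integral_inner h2 s]
  change smoothSq μ t x - 2 * inner ℝ s (smoothGrad μ t x) + ‖s‖ ^ 2 * smooth μ t x = _
  rw [hs, inner_smul_right, real_inner_self_eq_norm_sq]
  ring

/-- Jensen's inequality for the posterior: the score is a posterior mean, and the posterior variance
is nonnegative. -/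
theorem norm_sq_mul_smooth_le (ht : 0 < t) {x s : EuclideanSpace ℝ (Fin d)}
    (hs : smoothGrad μ t x = smooth μ t x • s) : ‖s‖ ^ 2 * smooth μ t x ≤ smoothSq μ t x := by
  have h := (integral_gaussKernel_mul_norm_sub_sq μ ht hs).2
  have : 0 ≤ ∫ y, gaussKernel t (x - y) * ‖t⁻¹ • (y - x) - s‖ ^ 2 ∂μ :=
    integral_nonneg fun y => mul_nonneg (gaussKernel_pos ht _).le (by positivity)
  linarith

theorem integral_gaussKernel_mul_norm_sub_sq_le (ht : 0 < t) {x s : EuclideanSpace ℝ (Fin d)}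
    (hs : smoothGrad μ t x = smooth μ t x • s) :
    ∫ y, gaussKernel t (x - y) * ‖t⁻¹ • (y - x) - s‖ ^ 2 ∂μ ≤ smoothSq μ t x := by
  rw [(integral_gaussKernel_mul_norm_sub_sq μ ht hs).2]
  have := smooth_pos μ ht x
  have : 0 ≤ ‖s‖ ^ 2 * smooth μ t x := by positivity
  linarith

end Smooth

/-! ### From densities to measures -/

section Density

variable {d : ℕ} {t : ℝ} {p₀ : EuclideanSpace ℝ (Fin d) → ℝ}

theorem IsDensity.isProbabilityMeasure (h : IsDensity p₀) :
    IsProbabilityMeasure (densityMeasure p₀) := by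
  constructor
  rw [densityMeasure, withDensity_apply _ MeasurableSet.univ, Measure.restrict_univ,
    ← ofReal_integral_eq_lintegral_ofReal h.integrable (ae_of_all _ h.nonneg), h.integral_eq_one,
    ENNReal.ofReal_one]

theorem IsDensity.marginal_eq (h : IsDensity p₀) :
    marginal p₀ t = smooth (densityMeasure p₀) t := by
  ext x
  rw [marginal, smooth, densityMeasure, integral_withDensity_eq_integral_toReal_smul
    h.measurable.ennreal_ofReal (by simp)]
  refine integral_congr_ae (ae_of_all _ fun y => ?_)
  simp [ENNReal.toReal_ofReal (h.nonneg y), mul_comm]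

theorem IsDensity.score_eq (h : IsDensity p₀) (ht : 0 < t) (x : EuclideanSpace ℝ (Fin d)) :
    score p₀ t x =
      (smooth (densityMeasure p₀) t x)⁻¹ • smoothGrad (densityMeasure p₀) t x := by
  have := h.isProbabilityMeasure
  rw [score, h.marginal_eq, gradient_log_smooth _ ht]

theorem measurable_score : Measurable (score p₀ t) := by
  unfold score gradient
  exact (LinearIsometryEquiv.continuous _).measurable.comp (measurable_fderiv ℝ _)

end Density

/-! ### Chernoff bound and variance of independent sums -/

section Concentration

variable {Ω : Type*} [MeasurableSpace Ω] {P : Measure Ω} [IsProbabilityMeasure P]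

/-- The chord of `exp` over `[-1, 0]`. Being linear in `y`, it bounds the moment generating function
through the mean alone. -/
theorem exp_neg_le_one_sub {y : ℝ} (h0 : 0 ≤ y) (h1 : y ≤ 1) :
    Real.exp (-y) ≤ 1 - (1 - Real.exp (-1)) * y := by
  have h := convexOn_exp.2 (Set.mem_univ (0 : ℝ)) (Set.mem_univ (-1 : ℝ)) (sub_nonneg.2 h1) h0
    (by ring)
  simp only [smul_eq_mul, mul_zero, zero_add, mul_neg, mul_one, Real.exp_zero] at h
  linarith

/-- A multiplicative Chernoff bound for the lower tail of a sum of `[0, 1]`-valued variables. -/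
theorem measureReal_sum_le_half_mean {n : ℕ} {Y : Fin n → Ω → ℝ} {u : ℝ}
    (hm : ∀ i, Measurable (Y i)) (hi : iIndepFun Y P) (h0 : ∀ i ω, 0 ≤ Y i ω)
    (h1 : ∀ i ω, Y i ω ≤ 1) (hu : ∀ i, ∫ ω, Y i ω ∂P = u) :
    P.real {ω | ∑ i, Y i ω ≤ n * u / 2} ≤ Real.exp (-(n * u / 10)) := by
  rcases Nat.eq_zero_or_pos n with rfl | hn
  · simp
  have hu0 : 0 ≤ u := by
    rw [← hu ⟨0, hn⟩]; exact integral_nonneg (h0 _)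
  have hI : ∀ i, Integrable (Y i) P := fun i =>
    Integrable.of_bound (C := 1) (hm i).aestronglyMeasurable
      (ae_of_all _ fun ω => by rw [Real.norm_of_nonneg (h0 i ω)]; exact h1 i ω)
  have hmgf : ∀ i, mgf (Y i) P (-1) ≤ Real.exp (-((1 - Real.exp (-1)) * u)) := by
    intro i
    have : mgf (Y i) P (-1) ≤ ∫ ω, (1 - (1 - Real.exp (-1)) * Y i ω) ∂P := by
      refine integral_mono_of_nonneg (ae_of_all _ fun ω => (Real.exp_pos _).le)
        ((integrable_const 1).sub ((hI i).const_mul _)) (ae_of_all _ fun ω => ?_)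
      have := exp_neg_le_one_sub (h0 i ω) (h1 i ω)
      simpa using this
    rw [integral_sub (integrable_const 1) ((hI i).const_mul _), integral_const_mul, hu i] at this
    have h2 := Real.add_one_le_exp (-((1 - Real.exp (-1)) * u))
    simp only [integral_const, probReal_univ, smul_eq_mul, mul_one] at this
    linarith
  have hsum : mgf (∑ i, Y i) P (-1) ≤ Real.exp (-((1 - Real.exp (-1)) * u)) ^ n := by
    rw [hi.mgf_sum hm]
    calc _ ≤ ∏ _i : Fin n, Real.exp (-((1 - Real.exp (-1)) * u)) :=
          Finset.prod_le_prod (fun i _ => mgf_nonneg) (fun i _ => hmgf i)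
      _ = _ := by simp
  have hint : Integrable (fun ω => Real.exp (-1 * (∑ i, Y i) ω)) P := by
    refine Integrable.of_bound (C := 1) (Measurable.aestronglyMeasurable (by fun_prop))
      (ae_of_all _ fun ω => ?_)
    rw [Real.norm_of_nonneg (Real.exp_pos _).le, Real.exp_le_one_iff, Finset.sum_apply]
    have := Finset.sum_nonneg fun i (_ : i ∈ Finset.univ) => h0 i ω
    linarith
  have hch := measure_le_le_exp_mul_mgf (μ := P) (X := ∑ i, Y i) (t := -1) (n * u / 2)
    (by norm_num) hint
  simp only [Finset.sum_apply] at hch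
  refine hch.trans ((mul_le_mul_of_nonneg_left hsum (Real.exp_pos _).le).trans ?_)
  rw [← Real.exp_nat_mul, ← Real.exp_add, Real.exp_le_exp]
  -- The exponent is `nu/2 - (1 - e⁻¹) nu ≤ -0.13 nu`, which leaves room for `-nu/10`.
  have he : Real.exp (-1) ≤ 0.37 := by
    have := Real.exp_neg_one_lt_d9; linarith
  have hnu : 0 ≤ n * u := by positivity
  nlinarith

/-- The variance of a sum of independent copies of a bounded centred random vector. -/
theorem integral_norm_sum_sq {F G : Type*} [MeasurableSpace F]
    [NormedAddCommGroup G] [InnerProductSpace ℝ G] [CompleteSpace G] [MeasurableSpace G]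
    [BorelSpace G] [SecondCountableTopology G]
    {μ : Measure F} {n : ℕ} {X : Fin n → Ω → F}
    (hm : ∀ i, Measurable (X i)) (hi : iIndepFun X P) (hX : ∀ i, P.map (X i) = μ)
    {w : F → G} (hw : Measurable w) {b : ℝ} (hb : ∀ y, ‖w y‖ ≤ b) (h0 : ∫ y, w y ∂μ = 0) :
    ∫ ω, ‖∑ i, w (X i ω)‖ ^ 2 ∂P = n * ∫ y, ‖w y‖ ^ 2 ∂μ := by
  have hI : ∀ i, Integrable (fun ω => w (X i ω)) P := fun i =>
    Integrable.of_bound (C := b) (hw.comp (hm i)).aestronglyMeasurable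
      (ae_of_all _ fun ω => hb _)
  have hI2 : ∀ i j, Integrable (fun ω => inner ℝ (w (X i ω)) (w (X j ω))) P := fun i j => by
    refine Integrable.of_bound (C := b * b)
      ((hI i).aestronglyMeasurable.inner (hI j).aestronglyMeasurable)
      (ae_of_all _ fun ω => (norm_inner_le_norm _ _).trans ?_)
    have := hb (X i ω)
    have := hb (X j ω)
    have := norm_nonneg (w (X i ω))
    gcongr
    linarith
  have hE : ∀ i, ∫ ω, w (X i ω) ∂P = 0 := fun i => by
    rw [← h0, ← hX i, integral_map (hm i).aemeasurable hw.aestronglyMeasurable]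
  have hoff : ∀ i j, i ≠ j → ∫ ω, inner ℝ (w (X i ω)) (w (X j ω)) ∂P = 0 := by
    intro i j hij
    have h := ((hi.indepFun hij).comp hw hw).integral_bilin (hI i) (hI j) (innerSL ℝ)
    simp only [Function.comp_apply, hE, map_zero] at h
    exact h
  have hdiag : ∀ i, ∫ ω, inner ℝ (w (X i ω)) (w (X i ω)) ∂P = ∫ y, ‖w y‖ ^ 2 ∂μ := fun i => by
    simp_rw [real_inner_self_eq_norm_sq]
    rw [← hX i, integral_map (hm i).aemeasurable (hw.norm.pow_const 2).aestronglyMeasurable]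
  simp_rw [← real_inner_self_eq_norm_sq, sum_inner, inner_sum]
  rw [integral_finsetSum _ fun i _ => integrable_finsetSum _ fun j _ => hI2 i j]
  simp_rw [integral_finsetSum _ fun j _ => hI2 _ j]
  have : ∀ i, ∑ j, ∫ ω, inner ℝ (w (X i ω)) (w (X j ω)) ∂P = ∫ y, ‖w y‖ ^ 2 ∂μ := fun i => by
    rw [Finset.sum_eq_single i (fun j _ hj => hoff i j hj.symm) (by simp), hdiag]
  simp [this]

end Concentration

/-! ### Deterministic bounds for the estimator -/

section Estimator

variable {d n : ℕ} {t : ℝ}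

theorem threshold_eq (d n : ℕ) (t : ℝ) : threshold d n t = Real.log n / n * gaussPeak d t := by
  rw [threshold, gaussPeak]; ring

theorem log_natCast_pos (hn : 2 ≤ n) : 0 < Real.log n :=
  Real.log_pos (by exact_mod_cast hn)

/-- A uniform bound for the squared norms of the score estimator. -/
noncomputable def scoreBound (n : ℕ) (t : ℝ) : ℝ := 4 / t * (Real.log n + (Real.log n)⁻¹)

theorem scoreBound_pos (ht : 0 < t) (hn : 2 ≤ n) : 0 < scoreBound n t := by
  have := log_natCast_pos hn
  unfold scoreBound; positivity

/-- Cauchy-Schwarz with weights `φ_t(x - X i)`: the empirical counterpart of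
`norm_sq_mul_smooth_le`. -/
theorem norm_kdeGrad_sq_le (ht : 0 < t) (X : Fin n → EuclideanSpace ℝ (Fin d))
    (x : EuclideanSpace ℝ (Fin d)) :
    ‖kdeGrad X t x‖ ^ 2 ≤ kde X t x *
      (1 / (n : ℝ) * ∑ i, gaussKernel t (x - X i) * (‖x - X i‖ ^ 2 / t ^ 2)) := by
  have h1 : ‖kdeGrad X t x‖ ≤ 1 / (n : ℝ) * ∑ i, gaussKernel t (x - X i) * (‖x - X i‖ / t) := by
    rw [kdeGrad, norm_smul, Real.norm_of_nonneg (by positivity)]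
    calc _ ≤ 1 / ((n : ℝ) * t) * ∑ i, ‖gaussKernel t (x - X i) • (X i - x)‖ := by
          gcongr; exact norm_sum_le _ _
      _ = _ := by
          rw [one_div, mul_inv, mul_assoc, Finset.mul_sum, one_div]
          congr 1
          refine Finset.sum_congr rfl fun i _ => ?_
          rw [norm_smul, Real.norm_of_nonneg (gaussKernel_pos ht _).le, norm_sub_rev]
          ring
  have h2 : (∑ i, gaussKernel t (x - X i) * (‖x - X i‖ / t)) ^ 2 ≤
      (∑ i, gaussKernel t (x - X i)) *
        ∑ i, gaussKernel t (x - X i) * (‖x - X i‖ ^ 2 / t ^ 2) := by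
    refine Finset.sum_sq_le_sum_mul_sum_of_sq_le_mul _ (fun i _ => (gaussKernel_pos ht _).le)
      (fun i _ => mul_nonneg (gaussKernel_pos ht _).le (by positivity)) fun i _ => le_of_eq ?_
    ring
  calc ‖kdeGrad X t x‖ ^ 2
      ≤ (1 / (n : ℝ) * ∑ i, gaussKernel t (x - X i) * (‖x - X i‖ / t)) ^ 2 := by gcongr
    _ = (1 / (n : ℝ)) ^ 2 * (∑ i, gaussKernel t (x - X i) * (‖x - X i‖ / t)) ^ 2 := by ring
    _ ≤ (1 / (n : ℝ)) ^ 2 * ((∑ i, gaussKernel t (x - X i)) *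
        ∑ i, gaussKernel t (x - X i) * (‖x - X i‖ ^ 2 / t ^ 2)) := by gcongr
    _ = _ := by rw [kde]; ring

/-- The threshold is tuned to the Fenchel bound with `N = n`: `p̂ ≥ ρ_n` says exactly that `M/n ≤ p̂
/ log n`, so the additive error becomes a multiple of `p̂`. -/
theorem norm_scoreEst_sq_le (ht : 0 < t) (hn : 2 ≤ n) (X : Fin n → EuclideanSpace ℝ (Fin d))
    (x : EuclideanSpace ℝ (Fin d)) : ‖scoreEst X t x‖ ^ 2 ≤ scoreBound n t := by
  have hB := scoreBound_pos ht hn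
  have hl := log_natCast_pos hn
  have hn0 : (0 : ℝ) < n := by positivity
  have hM := gaussPeak_pos (d := d) ht
  unfold scoreEst
  split_ifs with h
  · rw [threshold_eq] at h
    have hk : 0 < kde X t x := lt_of_lt_of_le (by positivity) h
    have hMk : gaussPeak d t / n ≤ (Real.log n)⁻¹ * kde X t x := by
      rw [inv_mul_eq_div, le_div_iff₀ hl]
      calc gaussPeak d t / n * Real.log n = Real.log n / n * gaussPeak d t := by ring
        _ ≤ _ := h
    have hsq : 1 / (n : ℝ) * ∑ i, gaussKernel t (x - X i) * (‖x - X i‖ ^ 2 / t ^ 2) ≤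
        scoreBound n t * kde X t x := by
      calc _ ≤ 1 / (n : ℝ) * ∑ i, 4 / t * (Real.log n * gaussKernel t (x - X i) +
            gaussPeak d t / n) := by
            exact mul_le_mul_of_nonneg_left
              (Finset.sum_le_sum fun i _ => gaussKernel_mul_sq_le ht hn0 _) (by positivity)
        _ = 4 / t * (Real.log n * kde X t x + gaussPeak d t / n) := by
            rw [← Finset.mul_sum, Finset.sum_add_distrib, ← Finset.mul_sum, kde]
            simp only [Finset.sum_const, Finset.card_univ, Fintype.card_fin, nsmul_eq_mul]
            field_simp
        _ ≤ 4 / t * (Real.log n * kde X t x + (Real.log n)⁻¹ * kde X t x) := by gcongr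
        _ = _ := by rw [scoreBound]; ring
    rw [norm_smul, mul_pow, norm_inv, Real.norm_of_nonneg hk.le, inv_pow, inv_mul_le_iff₀
      (by positivity)]
    calc _ ≤ _ := norm_kdeGrad_sq_le ht X x
      _ ≤ kde X t x * (scoreBound n t * kde X t x) := by gcongr
      _ = _ := by ring
  · simpa using hB.le

/-- Exhibits the numerator of `ŝ - s` as an average of i.i.d. terms, centred when `s` is the true
score. -/
theorem kdeGrad_sub_kde_smul (X : Fin n → EuclideanSpace ℝ (Fin d))
    (x s : EuclideanSpace ℝ (Fin d)) : kdeGrad X t x - kde X t x • s =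
      (1 / (n : ℝ)) • ∑ i, gaussKernel t (x - X i) • (t⁻¹ • (X i - x) - s) := by
  have h1 : kdeGrad X t x = (1 / (n : ℝ)) • ∑ i, gaussKernel t (x - X i) • t⁻¹ • (X i - x) := by
    simp_rw [smul_comm (_ : ℝ) t⁻¹ (_ : EuclideanSpace ℝ (Fin d))]
    rw [kdeGrad, ← Finset.smul_sum, smul_smul, one_div, mul_inv, one_div]
  rw [h1, kde, mul_smul, Finset.sum_smul, ← smul_sub, ← Finset.sum_sub_distrib]
  simp_rw [← smul_sub]

/-- The two hypotheses rule out truncation, and `p̂⁻² p ≤ (2/p)² p = 4/p`. -/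
theorem norm_scoreEst_sub_sq_le_of_half_le {X : Fin n → EuclideanSpace ℝ (Fin d)}
    {x s : EuclideanSpace ℝ (Fin d)} {p : ℝ} (hp : 0 < p) (hpk : p / 2 ≤ kde X t x)
    (hth : threshold d n t ≤ p / 2) :
    ‖scoreEst X t x - s‖ ^ 2 * p ≤ 4 / p * ‖kdeGrad X t x - kde X t x • s‖ ^ 2 := by
  have hk : 0 < kde X t x := by linarith
  have e : scoreEst X t x - s = (kde X t x)⁻¹ • (kdeGrad X t x - kde X t x • s) := by
    rw [scoreEst, if_pos (hth.trans hpk), smul_sub, inv_smul_smul₀ hk.ne']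
  rw [e, norm_smul, mul_pow, norm_inv, Real.norm_of_nonneg hk.le, mul_right_comm]
  gcongr
  have : (kde X t x)⁻¹ ≤ (p / 2)⁻¹ := by gcongr
  calc (kde X t x)⁻¹ ^ 2 * p ≤ (p / 2)⁻¹ ^ 2 * p := by gcongr
    _ = 4 / p := by field_simp; norm_num

theorem norm_scoreEst_sub_sq_le (ht : 0 < t) (hn : 2 ≤ n) (X : Fin n → EuclideanSpace ℝ (Fin d))
    (x s : EuclideanSpace ℝ (Fin d)) :
    ‖scoreEst X t x - s‖ ^ 2 ≤ 2 * scoreBound n t + 2 * ‖s‖ ^ 2 := by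
  have h1 := norm_scoreEst_sq_le ht hn X x
  have h2 := norm_sub_le (scoreEst X t x) s
  have h3 := norm_nonneg (scoreEst X t x - s)
  nlinarith [sq_nonneg (‖scoreEst X t x‖ - ‖s‖)]

end Estimator

/-! ### Joint measurability of the estimator -/

section Measurability

variable {d n : ℕ} {t : ℝ}

theorem measurable_uncurry_kde : Measurable
    (fun z : (Fin n → EuclideanSpace ℝ (Fin d)) × EuclideanSpace ℝ (Fin d) => kde z.1 t z.2) := by
  unfold kde
  exact Continuous.measurable (by fun_prop)

theorem measurable_uncurry_kdeGrad : Measurable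
    (fun z : (Fin n → EuclideanSpace ℝ (Fin d)) × EuclideanSpace ℝ (Fin d) =>
      kdeGrad z.1 t z.2) := by
  unfold kdeGrad
  exact Continuous.measurable (by fun_prop)

theorem measurable_uncurry_scoreEst : Measurable
    (fun z : (Fin n → EuclideanSpace ℝ (Fin d)) × EuclideanSpace ℝ (Fin d) =>
      scoreEst z.1 t z.2) := by
  unfold scoreEst
  exact Measurable.ite (measurableSet_le measurable_const measurable_uncurry_kde)
    (measurable_uncurry_kde.inv.smul measurable_uncurry_kdeGrad) measurable_const

end Measurability

/-! ### Risk at a fixed point -/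

section PointwiseRisk

variable {d n : ℕ} {t : ℝ} {μ : Measure (EuclideanSpace ℝ (Fin d))} [IsProbabilityMeasure μ]
  {Ω : Type*} [MeasurableSpace Ω] {P : Measure Ω} [IsProbabilityMeasure P]
  {X : Fin n → Ω → EuclideanSpace ℝ (Fin d)}

/-- The hypothesis `hs` is the centring condition. In `φ_t²` one factor is bounded by `M`; the other
leaves a posterior variance, at most `q`. -/
theorem integral_norm_kdeGrad_sub_sq_le (ht : 0 < t) (hn : 2 ≤ n) (hm : ∀ i, Measurable (X i))
    (hi : iIndepFun X P) (hX : ∀ i, P.map (X i) = μ) {x s : EuclideanSpace ℝ (Fin d)}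
    (hs : smoothGrad μ t x = smooth μ t x • s) :
    Integrable (fun ω => ‖kdeGrad (fun i => X i ω) t x - kde (fun i => X i ω) t x • s‖ ^ 2) P ∧
    ∫ ω, ‖kdeGrad (fun i => X i ω) t x - kde (fun i => X i ω) t x • s‖ ^ 2 ∂P ≤
      gaussPeak d t * smoothSq μ t x / n := by
  have hn0 : (0 : ℝ) < n := by positivity
  have hM := gaussPeak_pos (d := d) ht
  set w : EuclideanSpace ℝ (Fin d) → EuclideanSpace ℝ (Fin d) := fun y =>
    gaussKernel t (x - y) • (t⁻¹ • (y - x) - s) with hw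
  set b := gaussPeak d t + 4 / t * gaussPeak d t + gaussPeak d t * ‖s‖
  have hb : ∀ y, ‖w y‖ ≤ b := by
    intro y
    simp only [hw, smul_sub (gaussKernel t (x - y))]
    refine (norm_sub_le _ _).trans (add_le_add (norm_gaussKernel_sub_smul_le ht x y) ?_)
    rw [norm_smul, Real.norm_of_nonneg (gaussKernel_pos ht _).le]
    gcongr
    exact gaussKernel_le ht _
  have hwc : Continuous w := by fun_prop
  have h0 : ∫ y, w y ∂μ = 0 := by
    have h1 := integrable_gaussKernel_sub_smul μ ht x
    have h2 := (integrable_gaussKernel_sub μ ht x).smul_const s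
    simp only [hw, smul_sub (gaussKernel t (x - _))]
    rw [integral_sub h1 h2, integral_smul_const]
    exact sub_eq_zero.2 hs
  have hsum := integral_norm_sum_sq hm hi hX hwc.measurable hb h0
  have hw2 : ∫ y, ‖w y‖ ^ 2 ∂μ ≤ gaussPeak d t * smoothSq μ t x := by
    have hI := (integral_gaussKernel_mul_norm_sub_sq μ ht hs).1
    calc ∫ y, ‖w y‖ ^ 2 ∂μ
        ≤ ∫ y, gaussPeak d t * (gaussKernel t (x - y) * ‖t⁻¹ • (y - x) - s‖ ^ 2) ∂μ := by
          refine integral_mono_of_nonneg (ae_of_all _ fun y => sq_nonneg _) (hI.const_mul _)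
            (ae_of_all _ fun y => ?_)
          have h1 := gaussKernel_pos ht (x - y)
          have h2 := gaussKernel_le ht (x - y)
          simp only [hw, norm_smul _ (_ - s), Real.norm_of_nonneg h1.le, mul_pow]
          calc _ = gaussKernel t (x - y) *
                (gaussKernel t (x - y) * ‖t⁻¹ • (y - x) - s‖ ^ 2) := by ring
            _ ≤ _ := by gcongr
      _ ≤ _ := by
          rw [integral_const_mul]
          gcongr
          exact integral_gaussKernel_mul_norm_sub_sq_le μ ht hs
  have e : ∀ ω, ‖kdeGrad (fun i => X i ω) t x - kde (fun i => X i ω) t x • s‖ ^ 2 =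
      (1 / (n : ℝ)) ^ 2 * ‖∑ i, w (X i ω)‖ ^ 2 := fun ω => by
    rw [kdeGrad_sub_kde_smul, norm_smul, mul_pow, Real.norm_of_nonneg (by positivity)]
  simp_rw [e]
  constructor
  · refine Integrable.of_bound (C := (1 / (n : ℝ)) ^ 2 * (n * b) ^ 2)
      (Measurable.aestronglyMeasurable (by fun_prop)) (ae_of_all _ fun ω => ?_)
    rw [Real.norm_of_nonneg (by positivity)]
    gcongr
    refine (norm_sum_le _ _).trans ((Finset.sum_le_sum fun i _ => hb _).trans (by simp))
  · rw [integral_const_mul, hsum]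
    calc _ = (∫ y, ‖w y‖ ^ 2 ∂μ) / n := by field_simp
      _ ≤ _ := by gcongr

omit [IsProbabilityMeasure μ] in
-- Chernoff for `φ_t / M ∈ [0, 1]`: the 10 in the hypothesis offsets the 1/10 in the exponent,
-- leaving `e^{-log n}`.
theorem measureReal_kde_lt_half_le (ht : 0 < t) (hn : 2 ≤ n) (hm : ∀ i, Measurable (X i))
    (hi : iIndepFun X P) (hX : ∀ i, P.map (X i) = μ) {x : EuclideanSpace ℝ (Fin d)}
    (hp : 10 * threshold d n t ≤ smooth μ t x) :
    P.real {ω | kde (fun i => X i ω) t x < smooth μ t x / 2} ≤ 1 / n := by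
  have hn0 : (0 : ℝ) < n := by positivity
  have hM := gaussPeak_pos (d := d) ht
  have h := measureReal_sum_le_half_mean (P := P) (u := smooth μ t x / gaussPeak d t)
    (Y := fun i ω => gaussKernel t (x - X i ω) / gaussPeak d t)
    (fun i => by have := hm i; fun_prop)
    (hi.comp (fun _ y => gaussKernel t (x - y) / gaussPeak d t) fun _ => by fun_prop)
    (fun i ω => div_nonneg (gaussKernel_pos ht _).le hM.le)
    (fun i ω => (div_le_one hM).2 (gaussKernel_le ht _))
    (fun i => by
      rw [integral_div, smooth, ← hX i, integral_map (hm i).aemeasurable (by fun_prop)])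
  calc _ ≤ _ := measureReal_mono ?_
    _ ≤ _ := h
    _ ≤ Real.exp (-Real.log n) := ?_
    _ = 1 / n := by rw [Real.exp_neg, Real.exp_log hn0, one_div]
  · intro ω hω
    simp only [Set.mem_ofPred_eq, kde] at hω ⊢
    rw [← Finset.sum_div, mul_div_assoc', div_right_comm, div_le_div_iff_of_pos_right hM]
    rw [one_div, inv_mul_lt_iff₀ hn0] at hω
    linarith
  · rw [threshold_eq] at hp
    rw [Real.exp_le_exp, neg_le_neg_iff, le_div_iff₀ (by norm_num), mul_div_assoc', le_div_iff₀ hM]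
    calc Real.log n * 10 * gaussPeak d t
        = n * (10 * (Real.log n / n * gaussPeak d t)) := by field_simp
      _ ≤ _ := by gcongr

/-- The sample-free bound, used wherever concentration is unavailable: on the exceptional event, at
low density and far from the origin. -/
theorem norm_scoreEst_sub_sq_mul_smooth_le (ht : 0 < t) (hn : 2 ≤ n)
    (Y : Fin n → EuclideanSpace ℝ (Fin d)) {x s : EuclideanSpace ℝ (Fin d)}
    (hs : smoothGrad μ t x = smooth μ t x • s) :
    ‖scoreEst Y t x - s‖ ^ 2 * smooth μ t x ≤
      2 * scoreBound n t * smooth μ t x + 2 * smoothSq μ t x := by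
  have h1 := norm_scoreEst_sub_sq_le ht hn Y x s
  have h2 := norm_sq_mul_smooth_le μ ht hs
  have h3 := mul_le_mul_of_nonneg_right h1 (smooth_pos μ ht x).le
  linarith

theorem lintegral_loss_le_of_threshold_le (ht : 0 < t) (hn : 2 ≤ n) (hm : ∀ i, Measurable (X i))
    (hi : iIndepFun X P) (hX : ∀ i, P.map (X i) = μ) {x s : EuclideanSpace ℝ (Fin d)}
    (hs : smoothGrad μ t x = smooth μ t x • s) (hp : 10 * threshold d n t ≤ smooth μ t x) :
    ∫⁻ ω, ENNReal.ofReal (‖scoreEst (fun i => X i ω) t x - s‖ ^ 2 * smooth μ t x) ∂P ≤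
      ENNReal.ofReal (4 / smooth μ t x * (gaussPeak d t * smoothSq μ t x / n) +
        (2 * scoreBound n t * smooth μ t x + 2 * smoothSq μ t x) * (1 / n)) := by
  have hp0 := smooth_pos μ ht x
  have hB := scoreBound_pos ht hn
  have hq := smoothSq_nonneg μ ht x
  have hth : 0 ≤ threshold d n t := by
    have := log_natCast_pos hn
    have := gaussPeak_pos (d := d) ht
    rw [threshold_eq]; positivity
  set c := 2 * scoreBound n t * smooth μ t x + 2 * smoothSq μ t x with hc
  have hc0 : 0 ≤ c := by positivity
  set A := {ω | kde (fun i => X i ω) t x < smooth μ t x / 2} with hA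
  have hAm : MeasurableSet A := by
    refine measurableSet_lt ?_ measurable_const
    unfold kde
    fun_prop
  obtain ⟨hI, hle⟩ := integral_norm_kdeGrad_sub_sq_le ht hn hm hi hX hs
  have hpt : ∀ ω, ENNReal.ofReal (‖scoreEst (fun i => X i ω) t x - s‖ ^ 2 * smooth μ t x) ≤
      ENNReal.ofReal (4 / smooth μ t x *
        ‖kdeGrad (fun i => X i ω) t x - kde (fun i => X i ω) t x • s‖ ^ 2) +
      A.indicator (fun _ => ENNReal.ofReal c) ω := by
    intro ω
    by_cases hω : ω ∈ A
    · rw [Set.indicator_of_mem hω]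
      refine le_add_left (ENNReal.ofReal_le_ofReal ?_)
      exact norm_scoreEst_sub_sq_mul_smooth_le ht hn _ hs
    · refine le_add_right (ENNReal.ofReal_le_ofReal ?_)
      exact norm_scoreEst_sub_sq_le_of_half_le hp0 (not_lt.1 hω) (by linarith)
  calc _ ≤ _ := lintegral_mono hpt
    _ = ENNReal.ofReal (∫ ω, 4 / smooth μ t x *
          ‖kdeGrad (fun i => X i ω) t x - kde (fun i => X i ω) t x • s‖ ^ 2 ∂P) +
        ENNReal.ofReal c * P A := by
      rw [lintegral_add_right _ (measurable_const.indicator hAm), lintegral_indicator_const hAm,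
        ofReal_integral_eq_lintegral_ofReal (hI.const_mul _)
          (ae_of_all _ fun ω => by positivity)]
    _ ≤ ENNReal.ofReal (4 / smooth μ t x * (gaussPeak d t * smoothSq μ t x / n)) +
        ENNReal.ofReal c * ENNReal.ofReal (1 / n) := by
      rw [integral_const_mul, ← ofReal_measureReal]
      gcongr
      exact measureReal_kde_lt_half_le ht hn hm hi hX hp
    _ = _ := by
      have := gaussPeak_pos (d := d) ht
      rw [← ENNReal.ofReal_mul hc0, ← ENNReal.ofReal_add (by positivity) (by positivity)]

/-- The pointwise risk of the score estimator is of order `n⁻¹ t^{-1-d/2}` up to logarithms. -/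
theorem lintegral_loss_le (ht : 0 < t) (hn : 2 ≤ n) (hm : ∀ i, Measurable (X i))
    (hi : iIndepFun X P) (hX : ∀ i, P.map (X i) = μ) {x s : EuclideanSpace ℝ (Fin d)}
    (hs : smoothGrad μ t x = smooth μ t x • s) :
    ∫⁻ ω, ENNReal.ofReal (‖scoreEst (fun i => X i ω) t x - s‖ ^ 2 * smooth μ t x) ∂P ≤
      ENNReal.ofReal (168 * (Real.log n + (Real.log n)⁻¹) ^ 2 * (gaussPeak d t / (n * t))) := by
  have hn0 : (0 : ℝ) < n := by positivity
  have hM := gaussPeak_pos (d := d) ht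
  have hp0 := smooth_pos μ ht x
  have hpM := smooth_le μ ht x
  have hq0 := smoothSq_nonneg μ ht x
  have hq := smoothSq_le μ ht hn0 x
  have hl := log_natCast_pos hn
  have hli : 0 < (Real.log n)⁻¹ := by positivity
  have hlli : Real.log n * (Real.log n)⁻¹ = 1 := mul_inv_cancel₀ hl.ne'
  have hBdef : scoreBound n t = 4 / t * (Real.log n + (Real.log n)⁻¹) := rfl
  set ℓ := Real.log n
  set p := smooth μ t x
  set q := smoothSq μ t x
  set M := gaussPeak d t
  set L := ℓ + ℓ⁻¹ with hL
  have hℓL : ℓ ≤ L := by linarith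
  have hL1 : 1 ≤ L := by
    have : 1 ≤ L ^ 2 := by rw [hL]; nlinarith [sq_nonneg ℓ, sq_nonneg ℓ⁻¹]
    nlinarith
  rcases le_total (10 * threshold d n t) p with hp | hp
  · refine (lintegral_loss_le_of_threshold_le ht hn hm hi hX hs hp).trans
      (ENNReal.ofReal_le_ofReal ?_)
    rw [threshold_eq] at hp
    have hMn : M / n ≤ ℓ⁻¹ * p := by
      rw [inv_mul_eq_div, le_div_iff₀ hl]
      have : M / n * ℓ = ℓ / n * M := by ring
      have : 0 ≤ ℓ / n * M := by positivity
      linarith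
    have hqp : q ≤ 4 / t * (L * p) := by
      refine hq.trans ?_
      gcongr
      rw [hL, add_mul]; linarith
    -- The bound `q ≲ L p / t` cancels `1/p`, which makes the estimate uniform in `x`.
    have h1 : 4 / p * (M * q / n) ≤ 16 * L * (M / (n * t)) := by
      calc 4 / p * (M * q / n) ≤ 4 / p * (M * (4 / t * (L * p)) / n) := by gcongr
        _ = _ := by field_simp; norm_num
    have hqM : q ≤ 4 / t * (L * M) := hqp.trans (by gcongr)
    have h2 : (2 * scoreBound n t * p + 2 * q) * (1 / n) ≤ 16 * L * (M / (n * t)) := by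
      rw [hBdef]
      calc _ ≤ (2 * (4 / t * L) * M + 2 * (4 / t * (L * M))) * (1 / n) := by gcongr
        _ = _ := by field_simp; norm_num
    have h3 : 0 ≤ M / (n * t) := by positivity
    calc _ ≤ (32 * L) * (M / (n * t)) := by linarith
      _ ≤ _ := mul_le_mul_of_nonneg_right (by nlinarith) h3
  · have hb : ∀ ω, ENNReal.ofReal (‖scoreEst (fun i => X i ω) t x - s‖ ^ 2 * p) ≤
        ENNReal.ofReal (168 * L ^ 2 * (M / (n * t))) := by
      intro ω
      refine ENNReal.ofReal_le_ofReal ?_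
      refine (norm_scoreEst_sub_sq_mul_smooth_le ht hn _ hs).trans ?_
      rw [threshold_eq] at hp
      change 2 * scoreBound n t * p + 2 * q ≤ _
      rw [hBdef]
      change p ≤ 10 * (ℓ / n * M) at hp
      calc 2 * (4 / t * L) * p + 2 * q
          ≤ 2 * (4 / t * L) * (10 * (ℓ / n * M)) +
            2 * (4 / t * (ℓ * (10 * (ℓ / n * M)) + M / n)) := by
            have : q ≤ 4 / t * (ℓ * (10 * (ℓ / n * M)) + M / n) := hq.trans (by gcongr)
            gcongr
        _ = (80 * (L * ℓ) + 80 * (ℓ * ℓ) + 8) * (M / (n * t)) := by field_simp; ring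
        -- `168 = 80 + 80 + 8`, each of `L ℓ`, `ℓ²` and `1` being at most `L²`.
        _ ≤ _ := by
            gcongr
            nlinarith
    calc _ ≤ _ := lintegral_mono hb
      _ = _ := by simp

end PointwiseRisk

/-! ### Exponential moments and the region outside a ball -/

section Tail

variable {d : ℕ} {t : ℝ}

theorem integrable_exp_neg_mul_norm_rpow (hd : 1 ≤ d) {c γ : ℝ} (hc : 0 < c) (hγ : 0 < γ) :
    Integrable (fun y : EuclideanSpace ℝ (Fin d) => Real.exp (-c * ‖y‖ ^ γ)) := by
  have : Nonempty (Fin d) := ⟨⟨0, hd⟩⟩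
  rw [integrable_fun_norm_addHaar volume (f := fun r => Real.exp (-c * r ^ γ))]
  have h := integrableOn_rpow_mul_exp_neg_mul_rpow (s := ((d - 1 : ℕ) : ℝ)) (p := γ) (b := c)
    (by have : (0 : ℝ) ≤ ((d - 1 : ℕ) : ℝ) := by positivity
        linarith) hγ hc
  simpa [Real.rpow_natCast] using h

/-- A uniform stretched-exponential moment bound for all densities with a given tail. -/
theorem exists_lintegral_exp_norm_rpow_le (hd : 1 ≤ d) {γ θ c₁ C₁ : ℝ} (hγ : 0 < γ) (hθ : 0 < θ)
    (hθγ : θ ≤ γ) (hc₁ : 0 < c₁) (hC₁ : 0 < C₁) :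
    ∃ D : ℝ, 0 ≤ D ∧ ∀ p₀ : EuclideanSpace ℝ (Fin d) → ℝ, IsDensity p₀ → ExpTail γ c₁ C₁ p₀ →
      ∫⁻ y, ENNReal.ofReal (Real.exp (c₁ / 2 * ‖y‖ ^ θ)) ∂densityMeasure p₀ ≤
        ENNReal.ofReal D := by
  -- Half of the rate `c₁` pays for the moment and half remains for integrability; `e^{c₁/2}` comes
  -- from `‖y‖^θ ≤ 1 + ‖y‖^γ`.
  have hI : Integrable (fun y : EuclideanSpace ℝ (Fin d) =>
      Real.exp (c₁ / 2) * C₁ * Real.exp (-(c₁ / 2) * ‖y‖ ^ γ)) :=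
    (integrable_exp_neg_mul_norm_rpow hd (half_pos hc₁) hγ).const_mul _
  refine ⟨∫ y : EuclideanSpace ℝ (Fin d),
    Real.exp (c₁ / 2) * C₁ * Real.exp (-(c₁ / 2) * ‖y‖ ^ γ),
    integral_nonneg fun y => by positivity, fun p₀ hp htail => ?_⟩
  rw [ofReal_integral_eq_lintegral_ofReal hI (ae_of_all _ fun y => by positivity), densityMeasure,
    lintegral_withDensity_eq_lintegral_mul _ hp.measurable.ennreal_ofReal (by fun_prop)]
  refine lintegral_mono fun y => ?_
  rw [Pi.mul_apply, ← ENNReal.ofReal_mul (hp.nonneg y)]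
  refine ENNReal.ofReal_le_ofReal ?_
  have h1 : ‖y‖ ^ θ ≤ 1 + ‖y‖ ^ γ := by
    rcases le_total ‖y‖ 1 with h | h
    · have := Real.rpow_le_one (norm_nonneg y) h hθ.le
      have := Real.rpow_nonneg (norm_nonneg y) γ
      linarith
    · have := Real.rpow_le_rpow_of_exponent_le h hθγ
      linarith
  calc p₀ y * Real.exp (c₁ / 2 * ‖y‖ ^ θ)
      ≤ C₁ * Real.exp (-c₁ * ‖y‖ ^ γ) * Real.exp (c₁ / 2 * (1 + ‖y‖ ^ γ)) := by
        gcongr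
        exact htail y
    _ = C₁ * (Real.exp (-c₁ * ‖y‖ ^ γ) * Real.exp (c₁ / 2 * (1 + ‖y‖ ^ γ))) := by ring
    _ = C₁ * (Real.exp (c₁ / 2) * Real.exp (-(c₁ / 2) * ‖y‖ ^ γ)) := by
        rw [← Real.exp_add, ← Real.exp_add]; congr 2; ring
    _ = _ := by ring

theorem integral_gaussPeak_mul_exp (ht : 0 < t) :
    Integrable (fun z : EuclideanSpace ℝ (Fin d) =>
      gaussPeak d t * Real.exp (-(1 / (8 * t)) * ‖z‖ ^ 2)) ∧
    ∫ z : EuclideanSpace ℝ (Fin d), gaussPeak d t * Real.exp (-(1 / (8 * t)) * ‖z‖ ^ 2) =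
      4 ^ ((d : ℝ) / 2) := by
  have h := GaussianFourier.integral_rexp_neg_mul_sq_norm (V := EuclideanSpace ℝ (Fin d))
    (b := 1 / (8 * t)) (by positivity)
  have h2 : ∫ z : EuclideanSpace ℝ (Fin d),
      gaussPeak d t * Real.exp (-(1 / (8 * t)) * ‖z‖ ^ 2) = 4 ^ ((d : ℝ) / 2) := by
    rw [integral_const_mul, h, gaussPeak, finrank_euclideanSpace_fin, one_div_mul_eq_div,
      ← Real.div_rpow (by positivity) (by positivity)]
    congr 1
    have := Real.pi_pos
    field_simp
    norm_num
  refine ⟨?_, h2⟩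
  -- A non-integrable function would have integral 0, contradicting the positive value just
  -- computed.
  by_contra hcon
  rw [integral_undef hcon] at h2
  have : (0 : ℝ) < 4 ^ ((d : ℝ) / 2) := by positivity
  linarith

/-- Stretched-exponential moments of the Gaussian kernel, uniformly over bounded times. -/
theorem lintegral_gaussKernel_mul_exp_le {T β θ : ℝ} (ht : 0 < t) (htT : t ≤ T) (hβ : 0 < β)
    (hθ : 0 < θ) (hθ1 : θ ≤ 1) :
    ∫⁻ z : EuclideanSpace ℝ (Fin d), ENNReal.ofReal
        (gaussKernel t z * (1 + ‖z‖ ^ 2 / t) * Real.exp (β * ‖z‖ ^ θ)) ≤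
      ENNReal.ofReal (8 * Real.exp (β + β ^ 2 * T) * 4 ^ ((d : ℝ) / 2)) := by
  have hM := gaussPeak_pos (d := d) ht
  obtain ⟨hI, hint⟩ := integral_gaussPeak_mul_exp (d := d) ht
  rw [← hint, ← integral_const_mul,
    ofReal_integral_eq_lintegral_ofReal (hI.const_mul _) (ae_of_all _ fun z => by positivity)]
  refine lintegral_mono fun z => ENNReal.ofReal_le_ofReal ?_
  have h1 : ‖z‖ ^ θ ≤ 1 + ‖z‖ := by
    rcases le_total ‖z‖ 1 with h | h
    · have := Real.rpow_le_one (norm_nonneg z) h hθ.le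
      have := norm_nonneg z
      linarith
    · have := Real.rpow_le_rpow_of_exponent_le h hθ1
      rw [Real.rpow_one] at this
      linarith
  set a := ‖z‖ ^ 2 / t with ha
  have ha0 : 0 ≤ a := by positivity
  -- Exponent budget in units of `a`: of the Gaussian's 1/2, the stretched exponential uses 1/4 and
  -- the polynomial factor 1/8, leaving 1/8, a Gaussian of variance `4t`.
  have h2 : β * ‖z‖ ^ θ ≤ β + β ^ 2 * T + a / 4 := by
    have h3 : β * ‖z‖ ≤ β ^ 2 * t + a / 4 := by
      have : 0 ≤ (2 * β * t - ‖z‖) ^ 2 / (4 * t) := by positivity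
      have e : (2 * β * t - ‖z‖) ^ 2 / (4 * t) = β ^ 2 * t + a / 4 - β * ‖z‖ := by
        rw [ha]; field_simp; ring
      linarith
    have h4 : β ^ 2 * t ≤ β ^ 2 * T := by gcongr
    nlinarith
  have h5 : 1 + a ≤ 8 * Real.exp (a / 8) := by
    have := Real.add_one_le_exp (a / 8)
    linarith
  rw [gaussKernel_eq]
  calc gaussPeak d t * Real.exp (-‖z‖ ^ 2 / (2 * t)) * (1 + a) * Real.exp (β * ‖z‖ ^ θ)
      ≤ gaussPeak d t * Real.exp (-‖z‖ ^ 2 / (2 * t)) * (8 * Real.exp (a / 8)) *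
        Real.exp (β + β ^ 2 * T + a / 4) := by gcongr
    _ = gaussPeak d t * 8 * (Real.exp (-‖z‖ ^ 2 / (2 * t)) * Real.exp (a / 8) *
        Real.exp (β + β ^ 2 * T + a / 4)) := by ring
    _ = gaussPeak d t * 8 * (Real.exp (β + β ^ 2 * T) *
        Real.exp (-(1 / (8 * t)) * ‖z‖ ^ 2)) := by
        rw [← Real.exp_add, ← Real.exp_add, ← Real.exp_add]
        congr 2
        rw [ha]; field_simp; ring
    _ = _ := by ring

/-- Exponential Markov inequality for the smoothed density outside of a ball. -/
theorem lintegral_compl_ball_le {T β θ R a D : ℝ} (μ : Measure (EuclideanSpace ℝ (Fin d)))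
    [IsProbabilityMeasure μ] (ht : 0 < t) (htT : t ≤ T) (hβ : 0 < β)
    (hθ : 0 < θ) (hθ1 : θ ≤ 1) (hR : 0 ≤ R) (ha : 0 ≤ a)
    (hμ : ∫⁻ y, ENNReal.ofReal (Real.exp (β * ‖y‖ ^ θ)) ∂μ ≤ ENNReal.ofReal D) :
    ∫⁻ x in (Metric.ball (0 : EuclideanSpace ℝ (Fin d)) R)ᶜ,
        ENNReal.ofReal (a * smooth μ t x + a * t * smoothSq μ t x) ≤
      ENNReal.ofReal (a * Real.exp (-(β * R ^ θ)) *
        (8 * Real.exp (β + β ^ 2 * T) * 4 ^ ((d : ℝ) / 2)) * D) := by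
  set h : EuclideanSpace ℝ (Fin d) → ℝ := fun z => gaussKernel t z * (1 + ‖z‖ ^ 2 / t) with hh
  have hh0 : ∀ z, 0 ≤ h z := fun z => mul_nonneg (gaussKernel_pos ht z).le (by positivity)
  have hhc : Continuous h := by fun_prop
  have hI1 := integrable_gaussKernel_sub μ ht
  have hI2 := integrable_gaussKernel_sub_mul_sq μ ht
  have e : ∀ x y, h (x - y) =
      gaussKernel t (x - y) + t * (gaussKernel t (x - y) * (‖x - y‖ ^ 2 / t ^ 2)) := fun x y => by
    simp only [hh]; field_simp
  have hIh : ∀ x, Integrable (fun y => a * h (x - y)) μ := fun x => by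
    simp_rw [e]; exact ((hI1 x).add ((hI2 x).const_mul t)).const_mul a
  have hrepr : ∀ x, a * smooth μ t x + a * t * smoothSq μ t x = ∫ y, a * h (x - y) ∂μ :=
    fun x => by
      simp_rw [e]
      rw [integral_const_mul, integral_add (hI1 x) ((hI2 x).const_mul t), integral_const_mul,
        smooth, smoothSq]
      ring
  set E := a * Real.exp (-(β * R ^ θ)) with hE
  have hE0 : 0 ≤ E := by positivity
  have hpt : ∀ x ∈ (Metric.ball (0 : EuclideanSpace ℝ (Fin d)) R)ᶜ, ∀ y,
      a * h (x - y) ≤ E * ((h (x - y) * Real.exp (β * ‖x - y‖ ^ θ)) *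
        Real.exp (β * ‖y‖ ^ θ)) := by
    intro x hx y
    have hx' : R ≤ ‖x‖ := by simpa using hx
    -- Subadditivity of `r ↦ r^θ`, which needs `θ ≤ 1`, splits the weight into a kernel part and a
    -- `μ` part; Tonelli then factorises the integral.
    have h1 : R ^ θ ≤ ‖x - y‖ ^ θ + ‖y‖ ^ θ := by
      calc R ^ θ ≤ (‖x - y‖ + ‖y‖) ^ θ := by
            gcongr
            calc R ≤ ‖x‖ := hx'
              _ = ‖x - y + y‖ := by simp
              _ ≤ _ := norm_add_le _ _
        _ ≤ _ := Real.rpow_add_le_add_rpow (norm_nonneg _) (norm_nonneg _) hθ.le hθ1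
    have h2 : 1 ≤ Real.exp (-(β * R ^ θ)) *
        (Real.exp (β * ‖x - y‖ ^ θ) * Real.exp (β * ‖y‖ ^ θ)) := by
      rw [← Real.exp_add, ← Real.exp_add, Real.one_le_exp_iff]
      have := mul_le_mul_of_nonneg_left h1 hβ.le
      linarith
    calc a * h (x - y) ≤ a * h (x - y) * (Real.exp (-(β * R ^ θ)) *
        (Real.exp (β * ‖x - y‖ ^ θ) * Real.exp (β * ‖y‖ ^ θ))) :=
          le_mul_of_one_le_right (mul_nonneg ha (hh0 _)) h2
      _ = _ := by rw [hE]; ring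
  set H : EuclideanSpace ℝ (Fin d) → ℝ≥0∞ := fun z =>
    ENNReal.ofReal (h z * Real.exp (β * ‖z‖ ^ θ)) with hH
  set W : EuclideanSpace ℝ (Fin d) → ℝ≥0∞ := fun y => ENNReal.ofReal (Real.exp (β * ‖y‖ ^ θ))
    with hW
  have hHm : Measurable H := by
    have := hhc.measurable
    fun_prop
  have hWm : Measurable W := by fun_prop
  calc _ ≤ ∫⁻ x in (Metric.ball (0 : EuclideanSpace ℝ (Fin d)) R)ᶜ,
        ∫⁻ y, ENNReal.ofReal E * (H (x - y) * W y) ∂μ := by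
        refine setLIntegral_mono' Metric.isOpen_ball.measurableSet.compl fun x hx => ?_
        rw [hrepr, ofReal_integral_eq_lintegral_ofReal (hIh x)
          (ae_of_all _ fun y => mul_nonneg ha (hh0 _))]
        refine lintegral_mono fun y => ?_
        simp only [hH, hW]
        rw [← ENNReal.ofReal_mul (mul_nonneg (hh0 _) (Real.exp_pos _).le),
          ← ENNReal.ofReal_mul hE0]
        exact ENNReal.ofReal_le_ofReal (hpt x hx y)
    _ ≤ ∫⁻ x, ∫⁻ y, ENNReal.ofReal E * (H (x - y) * W y) ∂μ := setLIntegral_le_lintegral _ _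
    _ = ∫⁻ y, ∫⁻ x, ENNReal.ofReal E * (H (x - y) * W y) ∂volume ∂μ :=
        lintegral_lintegral_swap (f := fun x y => ENNReal.ofReal E * (H (x - y) * W y))
          (Measurable.aemeasurable (by fun_prop))
    _ = ENNReal.ofReal E * ((∫⁻ z, H z) * ∫⁻ y, W y ∂μ) := by
        have : ∀ y, ∫⁻ x, ENNReal.ofReal E * (H (x - y) * W y) =
            ENNReal.ofReal E * ((∫⁻ z, H z) * W y) := fun y => by
          rw [lintegral_const_mul _ (by fun_prop), lintegral_mul_const _ (by fun_prop),
            lintegral_sub_right_eq_self]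
        rw [lintegral_congr this, lintegral_const_mul _ (by fun_prop), lintegral_const_mul _ hWm]
    _ ≤ ENNReal.ofReal E * (ENNReal.ofReal (8 * Real.exp (β + β ^ 2 * T) * 4 ^ ((d : ℝ) / 2)) *
        ENNReal.ofReal D) := by
        gcongr
        exact lintegral_gaussKernel_mul_exp_le ht htT hβ hθ hθ1
    _ = _ := by
        rw [← ENNReal.ofReal_mul (by positivity), ← ENNReal.ofReal_mul hE0, mul_assoc E]

end Tail

/-! ### Integrated risk -/

theorem measurable_uncurry_loss {d n : ℕ} {t : ℝ} {p₀ : EuclideanSpace ℝ (Fin d) → ℝ}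
    (hp : IsDensity p₀) (ht : 0 < t) : Measurable
    (fun z : (Fin n → EuclideanSpace ℝ (Fin d)) × EuclideanSpace ℝ (Fin d) =>
      ENNReal.ofReal (‖scoreEst z.1 t z.2 - score p₀ t z.2‖ ^ 2 * marginal p₀ t z.2)) := by
  have := hp.isProbabilityMeasure
  have h1 := measurable_smooth (densityMeasure p₀) ht
  rw [← hp.marginal_eq] at h1
  exact (((measurable_uncurry_scoreEst.sub (measurable_score.comp measurable_snd)).norm.pow_const
    2).mul (h1.comp measurable_snd)).ennreal_ofReal

/-- The integrated risk bound, with the radius of the ball carrying the bulk of the mass free. -/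
theorem lintegral_weightedLoss_le {d n : ℕ} {t T β θ R D : ℝ}
    {p₀ : EuclideanSpace ℝ (Fin d) → ℝ} (hp : IsDensity p₀) (ht : 0 < t) (htT : t ≤ T)
    (hn : 2 ≤ n) (hβ : 0 < β) (hθ : 0 < θ) (hθ1 : θ ≤ 1) (hR : 0 ≤ R) (hD : 0 ≤ D) (hd : 1 ≤ d)
    (hμ : ∫⁻ y, ENNReal.ofReal (Real.exp (β * ‖y‖ ^ θ)) ∂densityMeasure p₀ ≤ ENNReal.ofReal D)
    {Ω : Type*} [MeasurableSpace Ω] {P : Measure Ω} [IsProbabilityMeasure P]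
    {X : Fin n → Ω → EuclideanSpace ℝ (Fin d)} (hm : ∀ i, Measurable (X i))
    (hi : iIndepFun X P) (hX : ∀ i, P.map (X i) = densityMeasure p₀) :
    ∫⁻ ω, weightedLoss p₀ (fun i => X i ω) t ∂P ≤ ENNReal.ofReal
      (168 * (Real.log n + (Real.log n)⁻¹) ^ 2 * (gaussPeak d t / (n * t)) *
        (R ^ d * volume.real (Metric.ball (0 : EuclideanSpace ℝ (Fin d)) 1)) +
      2 * scoreBound n t * Real.exp (-(β * R ^ θ)) *
        (8 * Real.exp (β + β ^ 2 * T) * 4 ^ ((d : ℝ) / 2)) * D) := by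
  have := hp.isProbabilityMeasure
  have : Nonempty (Fin d) := ⟨⟨0, hd⟩⟩
  have hM := gaussPeak_pos (d := d) ht
  have hB := scoreBound_pos ht hn
  have hl := log_natCast_pos hn
  have hs : ∀ x, smoothGrad (densityMeasure p₀) t x =
      smooth (densityMeasure p₀) t x • score p₀ t x := fun x => smoothGrad_eq ht (hp.score_eq ht x)
  -- Allows `2q ≤ 2B t q` with `B = scoreBound n t`, so that the deterministic bound fits the tail
  -- lemma with `a = 2B`.
  have hBt : 1 ≤ scoreBound n t * t := by
    have h1 : scoreBound n t * t = 4 * (Real.log n + (Real.log n)⁻¹) := by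
      rw [scoreBound]; field_simp
    have h2 : Real.log n * (Real.log n)⁻¹ = 1 := mul_inv_cancel₀ hl.ne'
    have h3 : 0 < (Real.log n)⁻¹ := by positivity
    nlinarith [sq_nonneg (Real.log n - (Real.log n)⁻¹)]
  have hmeas := (measurable_uncurry_loss (n := n) hp ht).comp
    (((measurable_pi_lambda _ hm).comp measurable_fst).prodMk measurable_snd)
  simp only [weightedLoss]
  rw [lintegral_lintegral_swap (f := fun ω x => ENNReal.ofReal
    (‖scoreEst (fun i => X i ω) t x - score p₀ t x‖ ^ 2 * marginal p₀ t x)) hmeas.aemeasurable,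
    hp.marginal_eq, ← lintegral_add_compl _ (Metric.isOpen_ball (x := 0) (ε := R)).measurableSet,
    ENNReal.ofReal_add (by positivity) (by positivity)]
  refine add_le_add ?_ ?_
  · calc _ ≤ ∫⁻ _ in Metric.ball (0 : EuclideanSpace ℝ (Fin d)) R, ENNReal.ofReal
          (168 * (Real.log n + (Real.log n)⁻¹) ^ 2 * (gaussPeak d t / (n * t))) :=
          lintegral_mono fun x => lintegral_loss_le ht hn hm hi hX (hs x)
      _ = _ := by
          rw [setLIntegral_const, Measure.addHaar_ball volume 0 hR, finrank_euclideanSpace_fin,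
            ← ofReal_measureReal (μ := volume) (s := Metric.ball 0 1),
            ← ENNReal.ofReal_mul (by positivity), ← ENNReal.ofReal_mul (by positivity)]
  · refine le_trans (lintegral_mono fun x => ?_) (lintegral_compl_ball_le (densityMeasure p₀)
      ht htT hβ hθ hθ1 hR (a := 2 * scoreBound n t) (by positivity) hμ)
    have hq := smoothSq_nonneg (densityMeasure p₀) ht x
    calc _ ≤ ∫⁻ _ω, ENNReal.ofReal (2 * scoreBound n t * smooth (densityMeasure p₀) t x +
          2 * scoreBound n t * t * smoothSq (densityMeasure p₀) t x) ∂P := by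
          refine lintegral_mono fun ω => ENNReal.ofReal_le_ofReal
            ((norm_scoreEst_sub_sq_mul_smooth_le ht hn _ (hs x)).trans ?_)
          have := mul_le_mul_of_nonneg_right hBt hq
          linarith
      _ = _ := by simp

theorem gaussPeak_le (d : ℕ) {t : ℝ} (ht : 0 < t) : gaussPeak d t ≤ t ^ (-((d : ℝ) / 2)) := by
  rw [gaussPeak, Real.rpow_neg ht.le, one_div]
  have : t ≤ 2 * Real.pi * t := by nlinarith [Real.pi_gt_three]
  gcongr

end ScoreKDE

/-! ### Choice of radius and constants -/

theorem theorem5 (d : ℕ) (hd : 1 ≤ d) (γ c₁ C₁ T : ℝ)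
    (hγ : 0 < γ) (hc₁ : 0 < c₁) (hC₁ : 0 < C₁) (hT : 0 < T) :
    ∃ C K : ℝ, 0 < C ∧ 0 < K ∧
      ∀ p₀ : EuclideanSpace ℝ (Fin d) → ℝ,
        ScoreKDE.IsDensity p₀ → ScoreKDE.ExpTail γ c₁ C₁ p₀ →
      ∀ n : ℕ, 2 ≤ n → ∀ t : ℝ, 0 < t → t ≤ T →
      ∀ (Ω : Type*) [MeasurableSpace Ω] (P : Measure Ω) [IsProbabilityMeasure P]
        (X : Fin n → Ω → EuclideanSpace ℝ (Fin d)),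
        (∀ i, Measurable (X i)) → iIndepFun X P →
        (∀ i, P.map (X i) = ScoreKDE.densityMeasure p₀) →
        ∫⁻ ω, ScoreKDE.weightedLoss p₀ (fun i => X i ω) t ∂P
          ≤ ENNReal.ofReal
              (C * Real.log n ^ K * (n : ℝ)⁻¹ * t ^ (-1 - (d : ℝ) / 2)) := by
  -- `θ ≤ γ` gives the moment bound, `θ ≤ 1` the subadditivity.
  have hθ : 0 < min γ 1 := lt_min hγ one_pos
  have hθ1 : min γ 1 ≤ 1 := min_le_right _ _
  obtain ⟨D, hD, hmom⟩ := ScoreKDE.exists_lintegral_exp_norm_rpow_le hd hγ hθ (min_le_left γ 1)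
    hc₁ hC₁
  set θ := min γ 1
  set β := c₁ / 2
  have hβ : 0 < β := half_pos hc₁
  have hlog2 : 0 < Real.log 2 := Real.log_pos (by norm_num)
  set V := volume.real (Metric.ball (0 : EuclideanSpace ℝ (Fin d)) 1)
  have hV : 0 ≤ V := measureReal_nonneg
  set G := 8 * Real.exp (β + β ^ 2 * T) * 4 ^ ((d : ℝ) / 2)
  have hG0 : 0 < G := by positivity
  set κ := 1 + (Real.log 2)⁻¹ ^ 2 with hκ
  set α := (d : ℝ) / θ with hα
  have hα0 : 0 ≤ α := by positivity
  -- The summands of `C` serve the ball, its complement and positivity. In `K`, the 2 comes from the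
  -- pointwise risk and `α = d/θ` from the volume of the ball.
  refine ⟨168 * κ ^ 2 * (β⁻¹ ^ α * V) +
    8 * κ * G * D * (Real.log 2)⁻¹ ^ (1 + α) * T ^ ((d : ℝ) / 2) + 1, 2 + α, by positivity,
    by positivity, ?_⟩
  intro p₀ hp htail n hn t ht htT Ω _ P _ X hm hi hX
  have hl := ScoreKDE.log_natCast_pos hn
  have hn0 : (0 : ℝ) < n := by positivity
  have hl2 : Real.log 2 ≤ Real.log n := Real.log_le_log (by norm_num) (by exact_mod_cast hn)
  set ℓ := Real.log n
  have hL : ℓ + ℓ⁻¹ ≤ κ * ℓ := by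
    have h1 : ℓ⁻¹ ≤ (Real.log 2)⁻¹ := by gcongr
    have h2 : ℓ⁻¹ = ℓ⁻¹ ^ 2 * ℓ := by field_simp
    have h3 : ℓ⁻¹ ^ 2 * ℓ ≤ (Real.log 2)⁻¹ ^ 2 * ℓ := by gcongr
    rw [hκ]; linarith
  -- Chosen so that `exp (-(β R^θ)) = 1/n`.
  set R := (ℓ / β) ^ (1 / θ) with hR
  have hR0 : 0 ≤ R := by positivity
  have hRθ : β * R ^ θ = ℓ := by
    rw [hR, ← Real.rpow_mul (by positivity), one_div_mul_cancel hθ.ne', Real.rpow_one]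
    field_simp
  have hRd : R ^ d = β⁻¹ ^ α * ℓ ^ α := by
    rw [hR, ← Real.rpow_natCast, ← Real.rpow_mul (by positivity), div_eq_inv_mul,
      Real.mul_rpow (by positivity) hl.le, hα]
    congr 2 <;> ring
  refine (ScoreKDE.lintegral_weightedLoss_le hp ht htT hn hβ hθ hθ1 hR0 hD hd (hmom p₀ hp htail)
    hm hi hX).trans (ENNReal.ofReal_le_ofReal ?_)
  rw [hRθ, hRd, Real.exp_neg, Real.exp_log hn0, ScoreKDE.scoreBound]
  set S := t ^ (-((d : ℝ) / 2)) with hS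
  have hS0 : 0 < S := by positivity
  have hM0 : 0 < ScoreKDE.gaussPeak d t := ScoreKDE.gaussPeak_pos ht
  have hM : ScoreKDE.gaussPeak d t ≤ S := ScoreKDE.gaussPeak_le d ht
  have hSt : t ^ (-1 - (d : ℝ) / 2) = t⁻¹ * S := by
    rw [hS, ← Real.rpow_neg_one, ← Real.rpow_add ht]; ring_nf
  -- The tail term lacks `t^{-d/2}` and some powers of `log n`; `t ≤ T` and `log n ≥ log 2` let both
  -- be inserted at the cost of a constant.
  have hTS : 1 ≤ T ^ ((d : ℝ) / 2) * S := by
    rw [hS, Real.rpow_neg ht.le, ← div_eq_mul_inv, one_le_div (by positivity)]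
    gcongr
  have hℓK : ℓ ^ (2 + α) = ℓ ^ 2 * ℓ ^ α := by
    rw [Real.rpow_add hl, Real.rpow_two]
  have hone : 1 ≤ (Real.log 2)⁻¹ ^ (1 + α) * (ℓ * ℓ ^ α) := by
    have : ℓ * ℓ ^ α = ℓ ^ (1 + α) := by rw [Real.rpow_add hl, Real.rpow_one]
    rw [this, ← Real.mul_rpow (by positivity) hl.le]
    refine Real.one_le_rpow ?_ (by positivity)
    rwa [inv_mul_eq_div, one_le_div hlog2]
  have hbulk : 168 * (ℓ + ℓ⁻¹) ^ 2 * (ScoreKDE.gaussPeak d t / (n * t)) *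
      (β⁻¹ ^ α * ℓ ^ α * V) ≤
      168 * κ ^ 2 * (β⁻¹ ^ α * V) * (ℓ ^ 2 * ℓ ^ α * (n : ℝ)⁻¹ * (t⁻¹ * S)) := by
    calc _ ≤ 168 * (κ * ℓ) ^ 2 * (S / (n * t)) * (β⁻¹ ^ α * ℓ ^ α * V) := by gcongr
      _ = _ := by field_simp
  have htailb : 2 * (4 / t * (ℓ + ℓ⁻¹)) * (n : ℝ)⁻¹ * G * D ≤
      8 * κ * G * D * (Real.log 2)⁻¹ ^ (1 + α) * T ^ ((d : ℝ) / 2) *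
        (ℓ ^ 2 * ℓ ^ α * (n : ℝ)⁻¹ * (t⁻¹ * S)) := by
    calc 2 * (4 / t * (ℓ + ℓ⁻¹)) * (n : ℝ)⁻¹ * G * D
        ≤ 2 * (4 / t * (κ * ℓ)) * (n : ℝ)⁻¹ * G * D * 1 := by rw [mul_one]; gcongr
      _ ≤ 2 * (4 / t * (κ * ℓ)) * (n : ℝ)⁻¹ * G * D *
          (((Real.log 2)⁻¹ ^ (1 + α) * (ℓ * ℓ ^ α)) * (T ^ ((d : ℝ) / 2) * S)) := by
          gcongr
          exact one_le_mul_of_one_le_of_one_le hone hTS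
      _ = _ := by ring
  have hrest : 0 ≤ ℓ ^ 2 * ℓ ^ α * (n : ℝ)⁻¹ * (t⁻¹ * S) := by positivity
  rw [hSt, hℓK]
  linarith
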